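/- Let $\alpha>0$. For $n\in\mathbb N$ let $x_j=\cos\frac{(j-1/2)\pi}{2n+1}$, $j=1,\dots,2n+1$, be the zeros of the Chebyshev polynomial $T_{2n+1}$ of the first kind, and let $P_{2n}^{(2)}$ be the unique polynomial of degree at most $2n$ with $P_{2n}^{(2)}(x_j)=|x_j|^\alpha$ for $j=1,\dots,2n+1$. For $x\ge 0$ put $$H(\alpha,x)=\int_0^\infty \frac{t^\alpha}{\sinh t}\,\frac{x\sin x}{x^2+t^2}\,dt ,$$ so that $H(\alpha,0)=0$. Then these integrals converge absolutely, $H(\alpha,\cdot)$ is measurable and bounded on $[0,\infty)$, and $$\lim_{n\to\infty}(2n)^\alpha\,\bigl\|\,|x|^\alpha-P_{2n}^{(2)}\bigr\|_{L_\infty[0,1]}=\frac2\pi\Bigl|\sin\frac{\pi\alpha}{2}\Bigr|\,\|H(\alpha,\cdot)\|_{L_\infty[0,\infty)},$$ where $$\|H(\alpha,\cdot)\|_{L_\infty[0,\infty)}=\sup_{x\in[0,\infty)}\int_0^\infty \frac{t^\alpha}{\sinh t}\,\frac{x\,|\sin x|}{x^2+t^2}\,dt .$$ -/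

import Mathlib

open MeasureTheory Filter Topology
open scoped ENNReal

noncomputable section

/-- The `L_∞` norm on `s ⊆ ℝ` with respect to Lebesgue measure, as a real number
(meaningful for functions with `MemLp f ∞ (volume.restrict s)`). -/
def normLInfty (f : ℝ → ℝ) (s : Set ℝ) : ℝ :=
  (eLpNorm f ∞ (volume.restrict s)).toReal

/-- The node `x_j = cos ((j - 1/2) π / (2n + 1))`; for `j = 1, …, 2n + 1` these are the zeros of
the Chebyshev polynomial `T_{2n+1}` of the first kind. -/
def chebNode (n j : ℕ) : ℝ :=
  Real.cos (((j : ℝ) - 1 / 2) * Real.pi / (2 * (n : ℝ) + 1))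

/-- The Lagrange polynomial of degree at most `2n` that interpolates `|x| ^ α` at the `2n + 1`
zeros of `T_{2n+1}`. -/
def chebInterp (α : ℝ) (n : ℕ) : Polynomial ℝ :=
  Lagrange.interpolate (Finset.Icc 1 (2 * n + 1)) (chebNode n) (fun j => |chebNode n j| ^ α)

/-- The integrand of `H(α, x)`, as a function of `t`. -/
def integrandH (α x t : ℝ) : ℝ :=
  t ^ α / Real.sinh t * (x * Real.sin x / (x ^ 2 + t ^ 2))

/-- `H(α, x) = ∫_0^∞ t^α / sinh t · x sin x / (x² + t²) dt`; in particular `H(α, 0) = 0`. -/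
def funH (α x : ℝ) : ℝ :=
  ∫ t in Set.Ioi (0 : ℝ), integrandH α x t

end

/-- The nodes are pairwise distinct and are exactly the zeros of `T_{2n+1}`. -/
theorem chebNode_zeros (n : ℕ) :
    Set.InjOn (chebNode n) (Finset.Icc 1 (2 * n + 1) : Finset ℕ) ∧
    ∀ x : ℝ, (Polynomial.Chebyshev.T ℝ (2 * (n : ℤ) + 1)).eval x = 0 ↔
      ∃ j ∈ Finset.Icc 1 (2 * n + 1), x = chebNode n j := by
  have hnode : ∀ k : ℕ, chebNode n (k + 1) =
      Real.cos ((2 * (k : ℝ) + 1) * Real.pi / (2 * ((2 * n + 1 : ℕ) : ℝ))) := by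
    intro k
    unfold chebNode
    congr 1
    push_cast
    field_simp
    ring
  have hinj := Multiset.inj_on_of_nodup_map (Polynomial.Chebyshev.roots_T_real_nodup (2 * n + 1))
  have hroots := Polynomial.Chebyshev.roots_T_real (2 * n + 1)
  have hne : Polynomial.Chebyshev.T ℝ (2 * (n : ℤ) + 1) ≠ 0 := by
    intro h
    have := Polynomial.Chebyshev.T_eval_one (R := ℝ) (2 * (n : ℤ) + 1)
    rw [h] at this
    simp at this
  refine ⟨?_, ?_⟩
  · intro i hi j hj hij
    simp only [Finset.coe_Icc, Set.mem_Icc] at hi hj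
    obtain ⟨a, rfl⟩ : ∃ a, i = a + 1 := ⟨i - 1, by omega⟩
    obtain ⟨b, rfl⟩ : ∃ b, j = b + 1 := ⟨j - 1, by omega⟩
    rw [hnode, hnode] at hij
    have := hinj a (by simp; omega) b (by simp; omega) hij
    omega
  · intro x
    have hx : (Polynomial.Chebyshev.T ℝ (2 * (n : ℤ) + 1)).eval x = 0 ↔
        x ∈ (Polynomial.Chebyshev.T ℝ ((2 * n + 1 : ℕ) : ℤ)).roots := by
      push_cast
      rw [Polynomial.mem_roots hne, Polynomial.IsRoot.def]
    rw [hx, hroots]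
    simp only [Finset.mem_val, Finset.mem_image, Finset.mem_range, Finset.mem_Icc]
    constructor
    · rintro ⟨k, hk, rfl⟩
      exact ⟨k + 1, by omega, (hnode k).symm⟩
    · rintro ⟨j, hj, rfl⟩
      obtain ⟨a, rfl⟩ : ∃ a, j = a + 1 := ⟨j - 1, by omega⟩
      exact ⟨a, by omega, (hnode a).symm⟩

/-- The defining property of the interpolation polynomial: it is the unique polynomial of degree
at most `2n` that agrees with `|x| ^ α` at the zeros of `T_{2n+1}`. -/
theorem chebInterp_unique (α : ℝ) (n : ℕ) (p : Polynomial ℝ) :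
    (p.degree < ((2 * n + 1 : ℕ) : WithBot ℕ) ∧
      ∀ x : ℝ, (Polynomial.Chebyshev.T ℝ (2 * (n : ℤ) + 1)).eval x = 0 → p.eval x = |x| ^ α) ↔
    p = chebInterp α n := by
  have h := Lagrange.eq_interpolate_iff (s := Finset.Icc 1 (2 * n + 1)) (v := chebNode n)
    (r := fun j => |chebNode n j| ^ α) (f := p) (chebNode_zeros n).1
  rw [chebInterp, ← h, Nat.card_Icc, Nat.add_sub_cancel]
  refine and_congr Iff.rfl ⟨fun hp i hi => ?_, fun hp x hx => ?_⟩
  · exact hp _ (((chebNode_zeros n).2 _).2 ⟨i, hi, rfl⟩)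
  · obtain ⟨j, hj, rfl⟩ := ((chebNode_zeros n).2 x).1 hx
    exact hp j hj

/-! Write α = b + 2k with 0 < b ≤ 2. For b < 2, a Beta integral represents |x|^α as (2/π) sin(πb/2)
∫₀^∞ s^(b-1) x^(2k+2)/(x²+s²) ds. Interpolation is linear, so the error for |x|^α is the same
integral of the errors for the kernels, and these are explicit: subtracting a multiple of x·T_N(x),
N = 2n+1, from x^(2k+2) makes the numerator divisible by x²+s² without changing it at the nodes
(`interpolation_error_cauchy_kernel`). With x = sin(φ/N) and s = sinh(t/N), T_N(x) becomes ± sin φ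
and T_N(is) becomes ± i sinh t. Hence N^α times the error is exactly (2/π) sin(πα/2) `scaledH α N φ`
(`rpow_mul_error_eq`). If b = 2, the sine vanishes and interpolation is exact for large n. As N → ∞,
`scaledH` approaches `funH` uniformly on 0 ≤ φ ≤ Nπ/2, the range that corresponds to x ∈ [0,1]
(`exists_tendsto_abs_scaledH_sub_funH_le`). Both functions whose norms occur are continuous, so the
essential suprema are suprema, and the limit of the norms follows. -/

/-! ### Beta integrals and the Cauchy-kernel representation of |x|^α. -/

theorem betaIntegral_one_sub_integrand {a v : ℝ} (hv : v ∈ Set.Ioo (0 : ℝ) 1) :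
    (v : ℂ) ^ ((a : ℂ) - 1) * (1 - (v : ℂ)) ^ (((1 - a : ℝ) : ℂ) - 1) =
      ((v ^ (a - 1) * (1 - v) ^ (-a) : ℝ) : ℂ) := by
  have h1 : (1 - (v : ℂ)) = ((1 - v : ℝ) : ℂ) := by push_cast; rfl
  have h2 : (((1 - a : ℝ) : ℂ) - 1) = ((-a : ℝ) : ℂ) := by push_cast; ring
  have h3 : ((a : ℂ) - 1) = ((a - 1 : ℝ) : ℂ) := by push_cast; rfl
  rw [h1, h2, h3, ← Complex.ofReal_cpow hv.1.le, ← Complex.ofReal_cpow (by linarith [hv.2]),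
    Complex.ofReal_mul]

theorem integrableOn_beta_one_sub {a : ℝ} (h0 : 0 < a) (h1 : a < 1) :
    IntegrableOn (fun v : ℝ => v ^ (a - 1) * (1 - v) ^ (-a)) (Set.Ioo 0 1) := by
  have h := Complex.betaIntegral_convergent (u := (a : ℂ)) (v := ((1 - a : ℝ) : ℂ))
    (by simpa using h0) (by simpa using h1)
  rw [intervalIntegrable_iff_integrableOn_Ioo_of_le zero_le_one] at h
  exact (h.congr_fun (fun v hv => betaIntegral_one_sub_integrand hv) measurableSet_Ioo).re

theorem integral_beta_one_sub {a : ℝ} (h0 : 0 < a) (h1 : a < 1) :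
    ∫ v in Set.Ioo (0 : ℝ) 1, v ^ (a - 1) * (1 - v) ^ (-a) = Real.pi / Real.sin (Real.pi * a) := by
  have h := Complex.betaIntegral_eq_Gamma_mul_div (a : ℂ) ((1 - a : ℝ) : ℂ)
    (by simpa using h0) (by simpa using h1)
  rw [Complex.betaIntegral, intervalIntegral.integral_of_le zero_le_one,
    integral_Ioc_eq_integral_Ioo,
    setIntegral_congr_fun measurableSet_Ioo (fun v hv => betaIntegral_one_sub_integrand hv),
    integral_complex_ofReal, ← Complex.ofReal_add, Complex.Gamma_ofReal, Complex.Gamma_ofReal,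
    Complex.Gamma_ofReal] at h
  rw [← Real.Gamma_mul_Gamma_one_sub]
  norm_cast at h
  simpa using h

/-- The substitution v = s²/(x²+s²) carries the Beta integral B(b/2, 1-b/2) over (0,1) to the
integral of s^(b-1)/(x²+s²) over (0,∞). -/
theorem image_sq_div_add_sq {x : ℝ} (hx : 0 < x) :
    (fun s : ℝ => s ^ 2 / (x ^ 2 + s ^ 2)) '' Set.Ioi 0 = Set.Ioo 0 1 := by
  ext v
  simp only [Set.mem_image, Set.mem_Ioi, Set.mem_Ioo]
  constructor
  · rintro ⟨s, hs, rfl⟩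
    refine ⟨by positivity, ?_⟩
    rw [div_lt_one (by positivity)]
    nlinarith
  · rintro ⟨h0, h1⟩
    have h2 : 0 < 1 - v := by linarith
    refine ⟨x * √(v / (1 - v)), by positivity, ?_⟩
    rw [mul_pow, Real.sq_sqrt (by positivity)]
    field_simp
    ring

theorem injOn_sq_div_add_sq {x : ℝ} (hx : 0 < x) :
    Set.InjOn (fun s : ℝ => s ^ 2 / (x ^ 2 + s ^ 2)) (Set.Ioi 0) := by
  intro s hs t ht h
  simp only [Set.mem_Ioi] at hs ht
  simp only at h
  rw [div_eq_div_iff (by positivity) (by positivity)] at h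
  have h2 : x ^ 2 * (s ^ 2) = x ^ 2 * t ^ 2 := by nlinarith
  have h3 := mul_left_cancel₀ (by positivity) h2
  exact (pow_left_inj₀ hs.le ht.le two_ne_zero).1 h3

theorem hasDerivAt_sq_div_add_sq {x : ℝ} (hx : 0 < x) (s : ℝ) :
    HasDerivAt (fun s : ℝ => s ^ 2 / (x ^ 2 + s ^ 2)) (2 * s * x ^ 2 / (x ^ 2 + s ^ 2) ^ 2) s := by
  refine ((hasDerivAt_pow 2 s).div ((hasDerivAt_pow 2 s).const_add (x ^ 2))
    (by positivity : x ^ 2 + s ^ 2 ≠ 0)).congr_deriv ?_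
  simp only [Nat.cast_ofNat, Nat.add_one_sub_one, pow_one]
  congr 1
  ring

theorem beta_substitution {b x s : ℝ} (hx : 0 < x) (hs : 0 < s) :
    |2 * s * x ^ 2 / (x ^ 2 + s ^ 2) ^ 2| • ((s ^ 2 / (x ^ 2 + s ^ 2)) ^ (b / 2 - 1) *
      (1 - s ^ 2 / (x ^ 2 + s ^ 2)) ^ (-(b / 2))) =
    2 * x ^ (2 - b) * (s ^ (b - 1) / (x ^ 2 + s ^ 2)) := by
  have h1 : 1 - s ^ 2 / (x ^ 2 + s ^ 2) = x ^ 2 / (x ^ 2 + s ^ 2) := by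
    field_simp
    ring
  have hr : ∀ y : ℝ, 0 < y → ∀ c : ℝ, (y ^ 2) ^ c = y ^ (2 * c) := fun y hy c => by
    rw [← Real.rpow_natCast, ← Real.rpow_mul hy.le]
    norm_num
  have hd : 0 < x ^ 2 + s ^ 2 := by positivity
  rw [h1, abs_of_nonneg (by positivity), smul_eq_mul, Real.div_rpow (by positivity) hd.le,
    Real.div_rpow (by positivity) hd.le, hr s hs, hr x hx, Real.rpow_sub hd, Real.rpow_neg hd.le,
    Real.rpow_one, show 2 * (b / 2 - 1) = b - 2 by ring, show 2 * -(b / 2) = -b by ring,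
    show 2 - b = 2 + -b by ring, Real.rpow_add hx,
    show b - 1 = b - 2 + 1 by ring, Real.rpow_add hs, Real.rpow_one,
    show (2 : ℝ) = ((2 : ℕ) : ℝ) by norm_num, Real.rpow_natCast]
  push_cast
  have := Real.rpow_pos_of_pos hd (b / 2)
  field_simp

theorem integrableOn_rpow_div_sq_add_sq {b x : ℝ} (h0 : 0 < b) (h2 : b < 2) (hx : 0 < x) :
    IntegrableOn (fun s : ℝ => s ^ (b - 1) / (x ^ 2 + s ^ 2)) (Set.Ioi 0) := by
  have h := integrableOn_beta_one_sub (a := b / 2) (by linarith) (by linarith)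
  rw [← image_sq_div_add_sq hx, integrableOn_image_iff_integrableOn_abs_deriv_smul
    measurableSet_Ioi (fun s _ => (hasDerivAt_sq_div_add_sq hx s).hasDerivWithinAt)
    (injOn_sq_div_add_sq hx)] at h
  have h' := (h.congr_fun (fun s hs => beta_substitution hx hs) measurableSet_Ioi).const_mul
    ((2 * x ^ (2 - b))⁻¹)
  have hp := Real.rpow_pos_of_pos hx (2 - b)
  refine h'.congr (ae_of_all _ fun s => ?_)
  simp only
  rw [inv_mul_cancel_left₀ (by positivity)]

theorem integral_rpow_div_sq_add_sq {b x : ℝ} (h0 : 0 < b) (h2 : b < 2) (hx : 0 < x) :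
    2 * x ^ (2 - b) * ∫ s in Set.Ioi (0 : ℝ), s ^ (b - 1) / (x ^ 2 + s ^ 2) =
      Real.pi / Real.sin (Real.pi * b / 2) := by
  have h := integral_beta_one_sub (a := b / 2) (by linarith) (by linarith)
  rw [← image_sq_div_add_sq hx, integral_image_eq_integral_abs_deriv_smul
    measurableSet_Ioi (fun s _ => (hasDerivAt_sq_div_add_sq hx s).hasDerivWithinAt)
    (injOn_sq_div_add_sq hx),
    setIntegral_congr_fun measurableSet_Ioi (fun s hs => beta_substitution hx hs),
    integral_const_mul] at h
  rw [h, mul_div_assoc]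

/-- Integral representation of `|x| ^ (b + 2k)` by Cauchy kernels. -/
theorem integrableOn_cauchy_kernel {b : ℝ} (h0 : 0 < b) (h2 : b < 2) (k : ℕ) (x : ℝ) :
    IntegrableOn (fun s : ℝ => s ^ (b - 1) * (x ^ (2 * k + 2) / (x ^ 2 + s ^ 2))) (Set.Ioi 0) := by
  rcases eq_or_ne x 0 with rfl | hx
  · simp
  · refine ((integrableOn_rpow_div_sq_add_sq h0 h2 (abs_pos.2 hx)).const_mul
      (x ^ (2 * k + 2))).congr (ae_of_all _ fun s => ?_)
    simp only [sq_abs]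
    ring

theorem integral_cauchy_kernel {b : ℝ} (h0 : 0 < b) (h2 : b < 2) (k : ℕ) (x : ℝ) :
    2 / Real.pi * Real.sin (Real.pi * b / 2) *
      ∫ s in Set.Ioi (0 : ℝ), s ^ (b - 1) * (x ^ (2 * k + 2) / (x ^ 2 + s ^ 2)) =
      |x| ^ (b + 2 * k) := by
  rcases eq_or_ne x 0 with rfl | hx
  · have : b + 2 * (k : ℝ) ≠ 0 := by positivity
    simp [Real.zero_rpow this]
  · have hx' := abs_pos.2 hx
    have h := integral_rpow_div_sq_add_sq h0 h2 hx'
    have hs : 0 < Real.sin (Real.pi * b / 2) :=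
      Real.sin_pos_of_pos_of_lt_pi (by positivity) (by nlinarith [Real.pi_pos])
    have he : ∀ s : ℝ, s ^ (b - 1) * (x ^ (2 * k + 2) / (x ^ 2 + s ^ 2)) =
        |x| ^ (2 * k + 2) * (s ^ (b - 1) / (|x| ^ 2 + s ^ 2)) := fun s => by
      rw [sq_abs, Even.pow_abs ⟨k + 1, by ring⟩]
      ring
    simp only [he]
    rw [integral_const_mul]
    have hr : |x| ^ (b + 2 * (k : ℝ)) * |x| ^ (2 - b) = |x| ^ (2 * k + 2) := by
      rw [← Real.rpow_add hx', ← Real.rpow_natCast]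
      congr 1
      push_cast
      ring
    have hI : ∫ s in Set.Ioi (0 : ℝ), s ^ (b - 1) / (|x| ^ 2 + s ^ 2) =
        Real.pi / Real.sin (Real.pi * b / 2) / (2 * |x| ^ (2 - b)) := by
      rw [← h, mul_div_cancel_left₀ _ (by positivity)]
    rw [hI, ← hr]
    have := Real.rpow_pos_of_pos hx' (2 - b)
    have := Real.pi_pos
    field_simp

/-! ### Interpolation of a single Cauchy kernel at the Chebyshev zeros. -/

theorem chebyshevT_eval_mul_I (n : ℕ) (u : ℝ) :
    (Polynomial.Chebyshev.T ℂ (2 * (n : ℤ) + 1)).eval ((Real.sinh u : ℂ) * Complex.I) =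
      (-1) ^ n * (Real.sinh ((2 * n + 1) * u) : ℂ) * Complex.I := by
  have h1 : (Real.sinh u : ℂ) * Complex.I = Complex.cos (Real.pi / 2 - u * Complex.I) := by
    rw [Complex.cos_pi_div_two_sub, Complex.sin_mul_I, Complex.ofReal_sinh]
  rw [h1, Polynomial.Chebyshev.T_complex_cos]
  have h2 : (((2 * (n : ℤ) + 1 : ℤ) : ℂ)) * (Real.pi / 2 - u * Complex.I) =
      Real.pi / 2 - ((2 * n + 1 : ℂ) * u * Complex.I - n * Real.pi) := by
    push_cast
    ring
  rw [h2, Complex.cos_pi_div_two_sub, Complex.sin_antiperiodic.sub_nat_mul_eq, Complex.sin_mul_I]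
  push_cast
  ring

theorem chebyshevT_eval_sin (n : ℕ) (θ : ℝ) :
    (Polynomial.Chebyshev.T ℝ (2 * (n : ℤ) + 1)).eval (Real.sin θ) =
      (-1) ^ n * Real.sin ((2 * n + 1) * θ) := by
  rw [← Real.cos_pi_div_two_sub, Polynomial.Chebyshev.T_real_cos]
  have h2 : (((2 * (n : ℤ) + 1 : ℤ) : ℝ)) * (Real.pi / 2 - θ) =
      Real.pi / 2 - ((2 * n + 1) * θ - n * Real.pi) := by
    push_cast
    ring
  rw [h2, Real.cos_pi_div_two_sub, Real.sin_sub_nat_mul_pi]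

/-- The interpolation error of the function `x ↦ x ^ (2k+2) / (x² + sinh² u)` at the zeros of
`T_{2n+1}`. -/
theorem interpolation_error_cauchy_kernel {n k : ℕ} (hk : k + 1 ≤ n) {u : ℝ} (hu : 0 < u) (θ : ℝ) :
    Real.sin θ ^ (2 * k + 2) / (Real.sin θ ^ 2 + Real.sinh u ^ 2) -
      ∑ j ∈ Finset.Icc 1 (2 * n + 1),
        chebNode n j ^ (2 * k + 2) / (chebNode n j ^ 2 + Real.sinh u ^ 2) *
          (Lagrange.basis (Finset.Icc 1 (2 * n + 1)) (chebNode n) j).eval (Real.sin θ) =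
    (-1) ^ k * Real.sinh u ^ (2 * k + 1) * Real.sin θ * Real.sin ((2 * n + 1) * θ) /
      (Real.sinh ((2 * n + 1) * u) * (Real.sin θ ^ 2 + Real.sinh u ^ 2)) := by
  have hs : 0 < Real.sinh u := Real.sinh_pos_iff.2 hu
  have hS : 0 < Real.sinh ((2 * n + 1) * u) := Real.sinh_pos_iff.2 (by positivity)
  set s := Real.sinh u
  set S := Real.sinh ((2 * n + 1) * u) with hSdef
  set T := Polynomial.Chebyshev.T ℝ (2 * (n : ℤ) + 1) with hT
  -- This value of c is forced by A(is) = 0, since T(is) = (-1)^n i S.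
  set c : ℝ := (-1) ^ (k + n) * s ^ (2 * k + 1) / S with hc
  set A : Polynomial ℝ := Polynomial.X ^ (2 * k + 2) - Polynomial.C c * (Polynomial.X * T) with hA
  have hAI : Polynomial.aeval ((s : ℂ) * Complex.I) A = 0 := by
    have h1 : Polynomial.aeval ((s : ℂ) * Complex.I) T =
        (-1) ^ n * (S : ℂ) * Complex.I := by
      rw [hSdef, ← chebyshevT_eval_mul_I, Polynomial.aeval_def, Polynomial.eval₂_eq_eval_map,
        hT, Polynomial.Chebyshev.map_T]
    have hS' : (S : ℂ) ≠ 0 := by exact_mod_cast hS.ne'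
    have hn : ((-1 : ℂ) ^ n) * (-1) ^ n = 1 := by rw [← mul_pow]; simp
    simp only [hA, map_sub, map_mul, map_pow, Polynomial.aeval_X, Polynomial.aeval_C, h1, hc,
      Complex.coe_algebraMap]
    push_cast
    rw [mul_pow, show 2 * k + 2 = 2 * (k + 1) by ring, pow_mul Complex.I, Complex.I_sq]
    field_simp
    rw [pow_add (-1 : ℂ) k n]
    linear_combination (-((s : ℂ) ^ (2 * k + 2) * (-1) ^ k * Complex.I ^ 2)) * hn +
      (-((s : ℂ) ^ (2 * k + 2) * (-1) ^ k)) * Complex.I_sq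
  -- A is real, so it vanishes at -is as well and X² + s² divides it. The quotient B is the
  -- interpolant: its degree is at most 2n because k + 1 ≤ n, and at a zero of T it equals the
  -- kernel.
  obtain ⟨B, hB⟩ := A.quadratic_dvd_of_aeval_eq_zero_im_ne_zero hAI (by simpa using hs.ne')
  have hq : Polynomial.X ^ 2 - Polynomial.C (2 * ((s : ℂ) * Complex.I).re) * Polynomial.X +
      Polynomial.C (‖(s : ℂ) * Complex.I‖ ^ 2) = Polynomial.X ^ 2 + Polynomial.C (s ^ 2) := by
    simp
  rw [hq] at hB
  have hBeval : ∀ x : ℝ, B.eval x = (x ^ (2 * k + 2) - c * (x * T.eval x)) / (x ^ 2 + s ^ 2) := by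
    intro x
    have h := congrArg (Polynomial.eval x) hB
    simp only [hA, Polynomial.eval_sub, Polynomial.eval_mul, Polynomial.eval_pow,
      Polynomial.eval_add, Polynomial.eval_X, Polynomial.eval_C] at h
    rw [h, mul_div_cancel_left₀ _ (by positivity)]
  have hTdeg : T.natDegree = 2 * n + 1 := by
    rw [hT, Polynomial.Chebyshev.natDegree_T]
    omega
  have hAdeg : A.natDegree ≤ 2 * n + 2 := by
    refine (Polynomial.natDegree_sub_le _ _).trans (max_le ?_ ?_)
    · rw [Polynomial.natDegree_X_pow]
      omega
    · refine (Polynomial.natDegree_C_mul_le _ _).trans (Polynomial.natDegree_mul_le.trans ?_)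
      rw [hTdeg, Polynomial.natDegree_X]
      omega
  have hBdeg : B.degree < (Finset.Icc 1 (2 * n + 1)).card := by
    rcases eq_or_ne B 0 with rfl | hB0
    · rw [Polynomial.degree_zero]
      exact WithBot.bot_lt_coe _
    have hq0 : (Polynomial.X ^ 2 + Polynomial.C (s ^ 2)).natDegree = 2 :=
      Polynomial.natDegree_X_pow_add_C
    have hq1 : (Polynomial.X ^ 2 + Polynomial.C (s ^ 2)) ≠ 0 := by
      intro h
      rw [h] at hq0
      simp at hq0
    rw [hB, Polynomial.natDegree_mul hq1 hB0, hq0] at hAdeg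
    rw [Nat.card_Icc, ← Polynomial.natDegree_lt_iff_degree_lt hB0]
    omega
  have hBint := Lagrange.eq_interpolate_of_eval_eq (s := Finset.Icc 1 (2 * n + 1))
    (v := chebNode n)
    (fun j => chebNode n j ^ (2 * k + 2) / (chebNode n j ^ 2 + s ^ 2))
    (chebNode_zeros n).1 hBdeg (fun j hj => by
      rw [hBeval, ((chebNode_zeros n).2 _).2 ⟨j, hj, rfl⟩]
      simp)
  have h := hBeval (Real.sin θ)
  rw [hBint, Lagrange.interpolate_apply, Polynomial.eval_finsetSum] at h
  simp only [Polynomial.eval_mul, Polynomial.eval_C] at h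
  rw [h, hT, chebyshevT_eval_sin, hc]
  have hn : ((-1 : ℝ) ^ n) * (-1) ^ n = 1 := by rw [← mul_pow]; simp
  have : 0 < Real.sin θ ^ 2 + s ^ 2 := by positivity
  field_simp
  rw [pow_add (-1 : ℝ) k n]
  linear_combination (s ^ (2 * k + 1) * Real.sin θ * (-1) ^ k *
    Real.sin ((2 * n + 1) * θ)) * hn

/-! ### Rescaling by N: the exact error formula. -/

/-- The weight `(N sinh (t/N)) ^ α cosh (t/N) / sinh t`, which tends to `t ^ α / sinh t`. -/
noncomputable def scaledWeight (α N t : ℝ) : ℝ :=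
  (N * Real.sinh (t / N)) ^ α * Real.cosh (t / N) / Real.sinh t

/-- The analogue of `funH` for the interpolation error at the `N` zeros of `T_N`. -/
noncomputable def scaledH (α N φ : ℝ) : ℝ :=
  ∫ t in Set.Ioi (0 : ℝ), scaledWeight α N t *
    (N * Real.sin (φ / N) * Real.sin φ /
      ((N * Real.sin (φ / N)) ^ 2 + (N * Real.sinh (t / N)) ^ 2))

theorem image_sinh_div_Ioi {N : ℝ} (hN : 0 < N) :
    (fun t : ℝ => Real.sinh (t / N)) '' Set.Ioi 0 = Set.Ioi 0 := by
  ext s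
  simp only [Set.mem_image, Set.mem_Ioi]
  constructor
  · rintro ⟨t, ht, rfl⟩
    exact Real.sinh_pos_iff.2 (by positivity)
  · intro hs
    refine ⟨N * Real.arsinh s, mul_pos hN (Real.arsinh_pos_iff.2 hs), ?_⟩
    rw [mul_div_cancel_left₀ _ hN.ne', Real.sinh_arsinh]

theorem integral_comp_sinh_div {N : ℝ} (hN : 0 < N) (F : ℝ → ℝ) :
    ∫ s in Set.Ioi (0 : ℝ), F s =
      ∫ t in Set.Ioi (0 : ℝ), Real.cosh (t / N) / N * F (Real.sinh (t / N)) := by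
  have h := integral_image_eq_integral_abs_deriv_smul (s := Set.Ioi (0 : ℝ))
    (f := fun t : ℝ => Real.sinh (t / N)) (f' := fun t => Real.cosh (t / N) / N)
    measurableSet_Ioi
    (fun t _ => (((hasDerivAt_id t).div_const N).sinh.congr_deriv
      (by simp only [id]; ring)).hasDerivWithinAt)
    (fun t _ t' _ htt => by
      have := Real.sinh_injective htt
      field_simp at this
      exact this) F
  rw [image_sinh_div_Ioi hN] at h
  rw [h]
  refine setIntegral_congr_fun measurableSet_Ioi fun t _ => ?_
  simp only [smul_eq_mul]
  rw [abs_of_pos (div_pos (Real.cosh_pos _) hN)]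

/-- The interpolant is a finite sum of nodal values times basis polynomials, so it commutes with the
integral over s. -/
theorem abs_rpow_sub_chebInterp_eval {b : ℝ} (h0 : 0 < b) (h2 : b < 2) (k n : ℕ) (x : ℝ) :
    |x| ^ (b + 2 * k) - (chebInterp (b + 2 * k) n).eval x =
      2 / Real.pi * Real.sin (Real.pi * b / 2) * ∫ s in Set.Ioi (0 : ℝ), s ^ (b - 1) *
        (x ^ (2 * k + 2) / (x ^ 2 + s ^ 2) - ∑ j ∈ Finset.Icc 1 (2 * n + 1),
          chebNode n j ^ (2 * k + 2) / (chebNode n j ^ 2 + s ^ 2) *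
          (Lagrange.basis (Finset.Icc 1 (2 * n + 1)) (chebNode n) j).eval x) := by
  have hF : ∀ s : ℝ, s ^ (b - 1) *
        (x ^ (2 * k + 2) / (x ^ 2 + s ^ 2) - ∑ j ∈ Finset.Icc 1 (2 * n + 1),
          chebNode n j ^ (2 * k + 2) / (chebNode n j ^ 2 + s ^ 2) *
          (Lagrange.basis (Finset.Icc 1 (2 * n + 1)) (chebNode n) j).eval x) =
      s ^ (b - 1) * (x ^ (2 * k + 2) / (x ^ 2 + s ^ 2)) - ∑ j ∈ Finset.Icc 1 (2 * n + 1),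
          s ^ (b - 1) * (chebNode n j ^ (2 * k + 2) / (chebNode n j ^ 2 + s ^ 2)) *
          (Lagrange.basis (Finset.Icc 1 (2 * n + 1)) (chebNode n) j).eval x := fun s => by
    simp only [mul_sub, Finset.mul_sum, mul_assoc]
  simp only [hF]
  rw [integral_sub (integrableOn_cauchy_kernel h0 h2 k x)
    (integrable_finsetSum _ fun j _ => (integrableOn_cauchy_kernel h0 h2 k _).mul_const _),
    integral_finsetSum _ fun j _ => (integrableOn_cauchy_kernel h0 h2 k _).mul_const _,
    mul_sub, integral_cauchy_kernel h0 h2, chebInterp, Lagrange.interpolate_apply,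
    Polynomial.eval_finsetSum, Finset.mul_sum]
  congr 1
  refine Finset.sum_congr rfl fun j _ => ?_
  rw [integral_mul_const, ← mul_assoc, integral_cauchy_kernel h0 h2]
  simp

/-- The scaled interpolation error, in closed form. -/
theorem rpow_mul_error_eq {b : ℝ} (h0 : 0 < b) (h2 : b < 2) {k n : ℕ} (hk : k + 1 ≤ n) (φ : ℝ) :
    (2 * (n : ℝ) + 1) ^ (b + 2 * k) * (|Real.sin (φ / (2 * n + 1))| ^ (b + 2 * k) -
      (chebInterp (b + 2 * k) n).eval (Real.sin (φ / (2 * n + 1)))) =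
    2 / Real.pi * Real.sin (Real.pi * (b + 2 * k) / 2) * scaledH (b + 2 * k) (2 * n + 1) φ := by
  have hN : (0 : ℝ) < 2 * n + 1 := by positivity
  -- The factor (-1)^k in the kernel error is thus absorbed into the sine.
  have hsin : Real.sin (Real.pi * (b + 2 * k) / 2) = (-1) ^ k * Real.sin (Real.pi * b / 2) := by
    rw [← Real.sin_add_nat_mul_pi]
    congr 1
    ring
  rw [abs_rpow_sub_chebInterp_eval h0 h2, integral_comp_sinh_div hN, hsin]
  have key : ∀ F : ℝ → ℝ, (2 * (n : ℝ) + 1) ^ (b + 2 * k) * ∫ t in Set.Ioi (0 : ℝ), F t =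
      (-1) ^ k * scaledH (b + 2 * k) (2 * n + 1) φ →
      (2 * (n : ℝ) + 1) ^ (b + 2 * k) * (2 / Real.pi * Real.sin (Real.pi * b / 2) *
        ∫ t in Set.Ioi (0 : ℝ), F t) =
      2 / Real.pi * ((-1) ^ k * Real.sin (Real.pi * b / 2)) *
        scaledH (b + 2 * k) (2 * n + 1) φ := fun F h => by
    linear_combination (2 / Real.pi * Real.sin (Real.pi * b / 2)) * h
  apply key
  rw [scaledH, ← integral_const_mul, ← integral_const_mul]
  refine setIntegral_congr_fun measurableSet_Ioi fun t ht => ?_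
  have ht : 0 < t := ht
  have hu : 0 < t / (2 * n + 1) := by positivity
  rw [interpolation_error_cauchy_kernel hk hu, scaledWeight, mul_div_cancel₀ _ hN.ne',
    mul_div_cancel₀ _ hN.ne']
  have hs := Real.sinh_pos_iff.2 hu
  have hst := Real.sinh_pos_iff.2 ht
  set N : ℝ := 2 * n + 1
  set s := Real.sinh (t / N)
  rw [Real.mul_rpow hN.le hs.le]
  have hr : s ^ (b + 2 * (k : ℝ)) = s ^ (b - 1) * s ^ (2 * k + 1) := by
    rw [← Real.rpow_natCast, ← Real.rpow_add hs]
    congr 1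
    push_cast
    ring
  rw [hr]
  have : 0 < Real.sin (φ / N) ^ 2 + s ^ 2 := by positivity
  have e : (N * Real.sin (φ / N)) ^ 2 + (N * s) ^ 2 = N ^ 2 * (Real.sin (φ / N) ^ 2 + s ^ 2) := by
    ring
  rw [e]
  field_simp

/-! ### Bounds and limits for the scaled weight and kernel. -/

theorem Real.sinh_le_mul_exp {x : ℝ} (_hx : 0 ≤ x) : Real.sinh x ≤ x * Real.exp x := by
  have h := Real.add_one_le_exp (-(2 * x))
  have h2 : Real.exp (-x) = Real.exp x * Real.exp (-(2 * x)) := by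
    rw [← Real.exp_add]
    congr 1
    ring
  rw [Real.sinh_eq, h2]
  nlinarith [Real.exp_pos x]

theorem Real.cosh_le_exp {x : ℝ} (hx : 0 ≤ x) : Real.cosh x ≤ Real.exp x := by
  have := Real.exp_le_exp.2 (by linarith : -x ≤ x)
  rw [Real.cosh_eq]
  linarith

/-- Equivalent to 1 + 2t ≤ e^(2t); it captures both the pole at 0 and the decay at infinity. -/
theorem Real.inv_sinh_le {t : ℝ} (ht : 0 < t) :
    (Real.sinh t)⁻¹ ≤ Real.exp (-t) * (1 + 2 * t) / t := by
  have hs := Real.sinh_pos_iff.2 ht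
  rw [inv_le_iff_one_le_mul₀ hs, Real.sinh_eq, div_mul_eq_mul_div, le_div_iff₀ ht]
  have h := Real.add_one_le_exp (2 * t)
  have e1 : Real.exp (-t) * Real.exp t = 1 := by rw [← Real.exp_add]; simp
  have e2 : Real.exp (-t) * Real.exp (-t) * Real.exp (2 * t) = 1 := by
    rw [← Real.exp_add, ← Real.exp_add, ← Real.exp_zero]
    congr 1
    ring
  have e3 := mul_le_mul_of_nonneg_left h (mul_pos (Real.exp_pos (-t)) (Real.exp_pos (-t))).le
  have e4 : Real.exp (-t) * (1 + 2 * t) * ((Real.exp t - Real.exp (-t)) / 2) =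
    (Real.exp (-t) * Real.exp t + 2 * t * (Real.exp (-t) * Real.exp t) -
      Real.exp (-t) * Real.exp (-t) * (2 * t + 1)) / 2 := by ring
  rw [e4, e1]
  linarith

/-- This is the dominating function throughout. The factor e^(t/2) gives up half of the decay of
1/sinh t to pay for the growth of `scaledWeight`; near 0 the function behaves like t^(α-1). -/
theorem integrableOn_rpow_mul_exp_half_div_sinh {α : ℝ} (hα : 0 < α) :
    IntegrableOn (fun t : ℝ => t ^ α * Real.exp (t / 2) / Real.sinh t) (Set.Ioi 0) := by
  have h1 := integrableOn_rpow_mul_exp_neg_mul_rpow (p := 1) (s := α - 1) (b := 1 / 2)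
    (by linarith) one_pos (by norm_num)
  have h2 := integrableOn_rpow_mul_exp_neg_mul_rpow (p := 1) (s := α) (b := 1 / 2)
    (by linarith) one_pos (by norm_num)
  refine Integrable.mono' (h1.add (h2.const_mul 2)) ?_ ?_
  · refine Measurable.aestronglyMeasurable ?_
    fun_prop
  · filter_upwards [ae_restrict_mem measurableSet_Ioi] with t (ht : 0 < t)
    have hs := Real.sinh_pos_iff.2 ht
    have hp := Real.rpow_pos_of_pos ht α
    rw [Real.norm_of_nonneg (by positivity)]
    simp only [Pi.add_apply, Real.rpow_one]
    have e : Real.exp (-(1 / 2) * t) = Real.exp (t / 2) * Real.exp (-t) := by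
      rw [← Real.exp_add]
      congr 1
      ring
    calc t ^ α * Real.exp (t / 2) / Real.sinh t
        = t ^ α * Real.exp (t / 2) * (Real.sinh t)⁻¹ := div_eq_mul_inv _ _
      _ ≤ t ^ α * Real.exp (t / 2) * (Real.exp (-t) * (1 + 2 * t) / t) := by
          gcongr
          exact Real.inv_sinh_le ht
      _ = _ := by
          rw [e, Real.rpow_sub ht, Real.rpow_one]
          field_simp

theorem le_mul_sinh_div {N t : ℝ} (hN : 0 < N) (ht : 0 < t) : t ≤ N * Real.sinh (t / N) := by
  have h := Real.self_le_sinh_iff.2 (by positivity : 0 ≤ t / N)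
  calc t = N * (t / N) := by field_simp
    _ ≤ _ := by gcongr

theorem mul_sinh_div_le {N t : ℝ} (hN : 0 < N) (ht : 0 < t) :
    N * Real.sinh (t / N) ≤ t * Real.exp (t / N) := by
  have h := Real.sinh_le_mul_exp (by positivity : 0 ≤ t / N)
  calc N * Real.sinh (t / N) ≤ N * (t / N * Real.exp (t / N)) := by gcongr
    _ = _ := by field_simp

theorem div_sinh_le_scaledWeight {α N t : ℝ} (hα : 0 < α) (hN : 0 < N) (ht : 0 < t) :
    t ^ α / Real.sinh t ≤ scaledWeight α N t := by
  have hs := Real.sinh_pos_iff.2 ht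
  rw [scaledWeight]
  gcongr
  calc t ^ α = t ^ α * 1 := (mul_one _).symm
    _ ≤ _ := by
      gcongr
      · exact le_mul_sinh_div hN ht
      · exact Real.one_le_cosh _

/-- The weight exceeds t^α / sinh t by a factor of at most e^(t(α+1)/N), whence the threshold on N.
-/
theorem scaledWeight_le {α N t : ℝ} (hα : 0 < α) (hN : 2 * (α + 1) ≤ N) (ht : 0 < t) :
    scaledWeight α N t ≤ t ^ α * Real.exp (t / 2) / Real.sinh t := by
  have hs := Real.sinh_pos_iff.2 ht
  have hN0 : 0 < N := by linarith
  have hw := le_mul_sinh_div hN0 ht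
  have hw' := mul_sinh_div_le hN0 ht
  rw [scaledWeight]
  refine div_le_div_of_nonneg_right ?_ hs.le
  calc (N * Real.sinh (t / N)) ^ α * Real.cosh (t / N)
      ≤ (t * Real.exp (t / N)) ^ α * Real.exp (t / N) := by
        refine mul_le_mul (Real.rpow_le_rpow (by linarith) hw' hα.le)
          (Real.cosh_le_exp (by positivity)) (Real.cosh_pos _).le (by positivity)
    _ = t ^ α * Real.exp (t * (α + 1) / N) := by
        rw [Real.mul_rpow ht.le (Real.exp_pos _).le, ← Real.exp_mul, mul_assoc, ← Real.exp_add]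
        congr 2
        ring
    _ ≤ _ := by
        refine mul_le_mul_of_nonneg_left (Real.exp_le_exp.2 ?_) (by positivity)
        rw [div_le_div_iff₀ hN0 two_pos]
        nlinarith

theorem tendsto_mul_sinh_div {t : ℝ} (ht : 0 < t) :
    Tendsto (fun N : ℝ => N * Real.sinh (t / N)) atTop (𝓝 t) := by
  have h0 : Tendsto (fun N : ℝ => t / N) atTop (𝓝 0) := tendsto_const_nhds.div_atTop tendsto_id
  have h1 : Tendsto (fun N : ℝ => t * Real.exp (t / N)) atTop (𝓝 t) := by
    simpa using ((Real.continuous_exp.tendsto 0).comp h0).const_mul t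
  refine tendsto_of_tendsto_of_tendsto_of_le_of_le' tendsto_const_nhds h1 ?_ ?_
  · filter_upwards [eventually_gt_atTop 0] with N hN using le_mul_sinh_div hN ht
  · filter_upwards [eventually_gt_atTop 0] with N hN using mul_sinh_div_le hN ht

theorem tendsto_scaledWeight {α t : ℝ} (ht : 0 < t) :
    Tendsto (fun N : ℝ => scaledWeight α N t) atTop (𝓝 (t ^ α / Real.sinh t)) := by
  have h0 : Tendsto (fun N : ℝ => t / N) atTop (𝓝 0) := tendsto_const_nhds.div_atTop tendsto_id
  have h1 := (Real.continuous_cosh.tendsto 0).comp h0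
  have h2 := (tendsto_mul_sinh_div ht).rpow_const (p := α) (Or.inl ht.ne')
  simpa [scaledWeight] using (h2.mul h1).div_const (Real.sinh t)

/-- Jordan's inequality, with 2/π weakened to 1/2. -/
theorem two_div_pi_mul_le {N φ : ℝ} (hN : 0 < N) (h0 : 0 ≤ φ) (h1 : φ ≤ N * (Real.pi / 2)) :
    φ ≤ 2 * (N * Real.sin (φ / N)) := by
  have h := Real.mul_le_sin (by positivity : 0 ≤ φ / N) (by rwa [div_le_iff₀' hN])
  have hpi := Real.pi_le_four
  have : 1 / 2 ≤ 2 / Real.pi := by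
    rw [div_le_div_iff₀ two_pos Real.pi_pos]
    linarith
  have h3 : 1 / 2 * (φ / N) ≤ Real.sin (φ / N) :=
    (mul_le_mul_of_nonneg_right this (by positivity)).trans h
  have h4 := mul_le_mul_of_nonneg_left h3 hN.le
  have h5 : N * (1 / 2 * (φ / N)) = φ / 2 := by field_simp
  linarith

theorem mul_sin_div_le {N φ : ℝ} (hN : 0 < N) (h0 : 0 ≤ φ) : N * Real.sin (φ / N) ≤ φ := by
  have h := mul_le_mul_of_nonneg_left (Real.sin_le (by positivity : 0 ≤ φ / N)) hN.le
  rwa [mul_div_cancel₀ _ hN.ne'] at h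

theorem sub_mul_sin_div_le {N φ : ℝ} (hN : 0 < N) (h0 : 0 < φ) :
    φ - N * Real.sin (φ / N) ≤ φ ^ 3 / (6 * N ^ 2) := by
  have h := mul_le_mul_of_nonneg_left (Real.sin_gt_sub_cube (by positivity : 0 < φ / N)).le hN.le
  have e : N * (φ / N - (φ / N) ^ 3 / 6) = φ - φ ^ 3 / (6 * N ^ 2) := by field_simp
  linarith

theorem abs_scaled_kernel_le {N φ w : ℝ} (hN : 0 < N) (h0 : 0 ≤ φ) (h1 : φ ≤ N * (Real.pi / 2)) :
    |N * Real.sin (φ / N) * Real.sin φ / ((N * Real.sin (φ / N)) ^ 2 + w ^ 2)| ≤ 2 := by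
  rcases h0.eq_or_lt with rfl | h0
  · simp
  have hy := two_div_pi_mul_le hN h0.le h1
  set y := N * Real.sin (φ / N)
  have hy0 : 0 < y := by linarith
  have hs : |Real.sin φ| ≤ φ := by simpa [abs_of_pos h0] using Real.abs_sin_le_abs (x := φ)
  rw [abs_div, abs_mul, abs_of_pos hy0, abs_of_pos (by positivity : 0 < y ^ 2 + w ^ 2),
    div_le_iff₀ (by positivity)]
  nlinarith [sq_nonneg w, mul_le_mul_of_nonneg_left (hs.trans hy) hy0.le]

theorem abs_div_sq_add_sq_sub_le {y φ w : ℝ} (hy : 0 < y) (hφ : y ≤ φ) :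
    |y / (y ^ 2 + w ^ 2) - φ / (φ ^ 2 + w ^ 2)| ≤ (φ - y) / (y * φ) := by
  have hφ0 : 0 < φ := by linarith
  have e : y / (y ^ 2 + w ^ 2) - φ / (φ ^ 2 + w ^ 2) =
      (φ - y) * ((y * φ - w ^ 2) / ((y ^ 2 + w ^ 2) * (φ ^ 2 + w ^ 2))) := by
    field_simp
    ring
  rw [e, abs_mul, abs_of_nonneg (sub_nonneg.2 hφ), div_eq_mul_one_div (φ - y)]
  refine mul_le_mul_of_nonneg_left ?_ (sub_nonneg.2 hφ)
  rw [abs_div, abs_of_pos (by positivity : 0 < (y ^ 2 + w ^ 2) * (φ ^ 2 + w ^ 2)),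
    div_le_div_iff₀ (by positivity) (by positivity), one_mul]
  have h1 : |y * φ - w ^ 2| ≤ y * φ + w ^ 2 :=
    abs_le.2 ⟨by nlinarith [mul_pos hy hφ0], by nlinarith [sq_nonneg w]⟩
  -- The second inequality is Cauchy–Schwarz for (y, w) and (φ, w).
  calc |y * φ - w ^ 2| * (y * φ) ≤ (y * φ + w ^ 2) * (y * φ + w ^ 2) := by
        have := mul_pos hy hφ0
        gcongr
        nlinarith [sq_nonneg w]
    _ ≤ _ := by nlinarith [sq_nonneg (w * (φ - y))]

/-- The bound is free of φ, which makes the later convergence uniform. Replacing N sin(φ/N) by φ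
costs 1/N, by the cubic bound for the sine; replacing w by t costs 1 - t²/w². -/
theorem abs_scaled_kernel_sub_le {N φ t w : ℝ} (hN : 0 < N) (h0 : 0 ≤ φ)
    (h1 : φ ≤ N * (Real.pi / 2)) (ht : 0 < t) (hw : t ≤ w) :
    |N * Real.sin (φ / N) * Real.sin φ / ((N * Real.sin (φ / N)) ^ 2 + w ^ 2) -
      φ * Real.sin φ / (φ ^ 2 + t ^ 2)| ≤ 1 / N + (1 - t ^ 2 / w ^ 2) := by
  have hw0 : 0 < w := by linarith
  have htw : t ^ 2 ≤ w ^ 2 := by gcongr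
  rcases h0.eq_or_lt with rfl | h0
  · have : t ^ 2 / w ^ 2 ≤ 1 := (div_le_one (by positivity)).2 htw
    have : 0 < 1 / N := by positivity
    simp only [zero_div, Real.sin_zero, mul_zero, sub_zero, abs_zero]
    linarith
  have hy := two_div_pi_mul_le hN h0.le h1
  have hyφ := mul_sin_div_le hN h0.le
  have hsub := sub_mul_sin_div_le hN h0
  set y := N * Real.sin (φ / N)
  have hy0 : 0 < y := by linarith
  have hs : |Real.sin φ| ≤ φ := by simpa [abs_of_pos h0] using Real.abs_sin_le_abs (x := φ)
  have hs1 := Real.abs_sin_le_one φ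
  have e : y * Real.sin φ / (y ^ 2 + w ^ 2) - φ * Real.sin φ / (φ ^ 2 + t ^ 2) =
      Real.sin φ * (y / (y ^ 2 + w ^ 2) - φ / (φ ^ 2 + w ^ 2)) -
        φ * Real.sin φ * (w ^ 2 - t ^ 2) / ((φ ^ 2 + w ^ 2) * (φ ^ 2 + t ^ 2)) := by
    field_simp
    ring
  rw [e]
  refine (abs_sub _ _).trans (add_le_add ?_ ?_)
  · rw [abs_mul]
    refine (mul_le_mul hs1 (abs_div_sq_add_sq_sub_le hy0 hyφ) (abs_nonneg _) zero_le_one).trans ?_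
    rw [one_mul, div_le_div_iff₀ (by positivity) hN, one_mul]
    have h4 : φ ≤ N * 2 := h1.trans (by
      have := Real.pi_le_four
      gcongr
      linarith)
    calc (φ - y) * N ≤ φ ^ 3 / (6 * N ^ 2) * N := by gcongr
      _ = φ ^ 2 * (φ / (6 * N)) := by field_simp
      _ ≤ φ ^ 2 * (1 / 2) := by
          refine mul_le_mul_of_nonneg_left ?_ (by positivity)
          rw [div_le_div_iff₀ (by positivity) two_pos]
          linarith
      _ ≤ y * φ := by nlinarith
  · rw [abs_div, abs_mul, abs_mul, abs_of_pos h0, abs_of_nonneg (sub_nonneg.2 htw),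
      abs_of_pos (by positivity : 0 < (φ ^ 2 + w ^ 2) * (φ ^ 2 + t ^ 2))]
    have h5 : 0 ≤ w ^ 2 - t ^ 2 := sub_nonneg.2 htw
    calc φ * |Real.sin φ| * (w ^ 2 - t ^ 2) / ((φ ^ 2 + w ^ 2) * (φ ^ 2 + t ^ 2))
        ≤ φ * φ * (w ^ 2 - t ^ 2) / (w ^ 2 * φ ^ 2) := by
          gcongr
          · nlinarith
          · nlinarith
      _ = _ := by field_simp

/-! ### Essential suprema of continuous functions. -/

theorem memLp_top_and_isLUB_normLInfty {f : ℝ → ℝ} (hf : Continuous f) {s : Set ℝ}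
    (hs : MeasurableSet s) (hne : s.Nonempty) (hcl : s ⊆ closure (interior s)) {C : ℝ}
    (hC : ∀ x ∈ s, |f x| ≤ C) :
    MemLp f ∞ (volume.restrict s) ∧ IsLUB ((fun x => |f x|) '' s) (normLInfty f s) := by
  have hmem : MemLp f ∞ (volume.restrict s) :=
    memLp_top_of_bound hf.aestronglyMeasurable C (by
      filter_upwards [ae_restrict_mem hs] with x hx using hC x hx)
  refine ⟨hmem, ?_, ?_⟩
  · have hae : ∀ᵐ x ∂(volume.restrict s), |f x| ≤ normLInfty f s := by
      filter_upwards [ae_le_eLpNormEssSup (f := f) (μ := volume.restrict s)] with x hx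
      rw [← eLpNorm_exponent_top] at hx
      have h := ENNReal.toReal_mono hmem.eLpNorm_ne_top hx
      rwa [toReal_enorm] at h
    -- Where the bound fails inside the interior is an open null set, hence empty; closedness then
    -- extends the bound to all of s.
    have hint : interior s ⊆ {x | |f x| ≤ normLInfty f s} := by
      have hopen : IsOpen (interior s ∩ {x | normLInfty f s < |f x|}) :=
        isOpen_interior.inter (isOpen_lt continuous_const hf.abs)
      have hnull : volume (interior s ∩ {x | normLInfty f s < |f x|}) = 0 := by
        rw [ae_restrict_iff' hs] at hae
        refine measure_mono_null (fun x hx => ?_) hae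
        simp only [Set.mem_compl_iff, Set.mem_ofPred_eq, Classical.not_imp, not_le]
        exact ⟨interior_subset hx.1, hx.2⟩
      have hempty := hopen.measure_eq_zero_iff volume |>.1 hnull
      intro x hx
      by_contra h
      exact Set.eq_empty_iff_forall_notMem.1 hempty x ⟨hx, Set.mem_ofPred_eq ▸ lt_of_not_ge h⟩
    have hclosed : IsClosed {x | |f x| ≤ normLInfty f s} := isClosed_le hf.abs continuous_const
    rintro _ ⟨x, hx, rfl⟩
    exact closure_minimal hint hclosed (hcl hx)
  · intro c hc
    obtain ⟨x₀, hx₀⟩ := hne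
    have hc0 : 0 ≤ c := (abs_nonneg _).trans (hc ⟨x₀, hx₀, rfl⟩)
    refine ENNReal.toReal_le_of_le_ofReal hc0 ?_
    rw [eLpNorm_exponent_top]
    refine eLpNormEssSup_le_of_ae_bound ?_
    filter_upwards [ae_restrict_mem hs] with x hx using hc ⟨x, hx, rfl⟩

/-! ### Integrability, continuity and boundedness of H. -/

theorem abs_mul_sin_div_le_one {x t : ℝ} (ht : 0 < t) :
    |x * Real.sin x / (x ^ 2 + t ^ 2)| ≤ 1 := by
  rw [abs_div, abs_mul, abs_of_pos (by positivity : 0 < x ^ 2 + t ^ 2),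
    div_le_one (by positivity)]
  have := Real.abs_sin_le_abs (x := x)
  nlinarith [abs_nonneg x, sq_abs x, sq_nonneg t]

theorem div_sinh_le_exp_half {α t : ℝ} (ht : 0 < t) :
    t ^ α / Real.sinh t ≤ t ^ α * Real.exp (t / 2) / Real.sinh t := by
  have hs := Real.sinh_pos_iff.2 ht
  have hp := Real.rpow_pos_of_pos ht α
  gcongr
  exact le_mul_of_one_le_right hp.le (Real.one_le_exp (by positivity))

theorem norm_integrandH_le (α x : ℝ) {t : ℝ} (ht : 0 < t) :
    ‖integrandH α x t‖ ≤ t ^ α * Real.exp (t / 2) / Real.sinh t := by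
  have hs := Real.sinh_pos_iff.2 ht
  refine le_trans ?_ (div_sinh_le_exp_half ht)
  rw [integrandH, norm_mul, Real.norm_of_nonneg (by positivity : 0 ≤ t ^ α / Real.sinh t)]
  exact mul_le_of_le_one_right (by positivity) (abs_mul_sin_div_le_one ht)

theorem measurable_integrandH (α x : ℝ) : Measurable (integrandH α x) := by
  unfold integrandH
  fun_prop

theorem integrableOn_integrandH {α : ℝ} (hα : 0 < α) (x : ℝ) :
    IntegrableOn (integrandH α x) (Set.Ioi 0) := by
  refine Integrable.mono' (integrableOn_rpow_mul_exp_half_div_sinh hα)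
    (measurable_integrandH α x).aestronglyMeasurable ?_
  filter_upwards [ae_restrict_mem measurableSet_Ioi] with t ht using norm_integrandH_le α x ht

theorem continuous_funH {α : ℝ} (hα : 0 < α) : Continuous (funH α) := by
  unfold funH
  refine continuous_of_dominated (fun x => (measurable_integrandH α x).aestronglyMeasurable)
    (fun x => ?_) (integrableOn_rpow_mul_exp_half_div_sinh hα) ?_
  · filter_upwards [ae_restrict_mem measurableSet_Ioi] with t ht using norm_integrandH_le α x ht
  · filter_upwards [ae_restrict_mem measurableSet_Ioi] with t (ht : 0 < t)
    unfold integrandH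
    refine continuous_const.mul (Continuous.div (by fun_prop) (by fun_prop) fun x => ?_)
    positivity

theorem abs_funH_le {α : ℝ} (hα : 0 < α) (x : ℝ) :
    |funH α x| ≤ ∫ t in Set.Ioi (0 : ℝ), t ^ α * Real.exp (t / 2) / Real.sinh t := by
  rw [funH, ← Real.norm_eq_abs]
  refine norm_integral_le_of_norm_le (integrableOn_rpow_mul_exp_half_div_sinh hα) ?_
  filter_upwards [ae_restrict_mem measurableSet_Ioi] with t ht using norm_integrandH_le α x ht

/-- sin x factors out of the integral, and what remains is nonnegative. -/
theorem integral_abs_sin_eq_abs_funH (α : ℝ) {x : ℝ} (hx : 0 ≤ x) :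
    ∫ t in Set.Ioi (0 : ℝ), t ^ α / Real.sinh t * (x * |Real.sin x| / (x ^ 2 + t ^ 2)) =
      |funH α x| := by
  have h1 : funH α x = Real.sin x *
      ∫ t in Set.Ioi (0 : ℝ), t ^ α / Real.sinh t * (x / (x ^ 2 + t ^ 2)) := by
    rw [funH, ← integral_const_mul]
    congr 1
    ext t
    rw [integrandH]
    ring
  rw [h1, abs_mul, abs_of_nonneg (setIntegral_nonneg measurableSet_Ioi fun t (ht : 0 < t) => ?_),
    ← integral_const_mul]
  · congr 1
    ext t
    ring
  · have := Real.sinh_pos_iff.2 ht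
    positivity

/-! ### Uniform convergence of the scaled integrals to H. -/

/-- Uniform closeness of `scaledH` and `funH` on the range of the angle `φ`. -/
theorem exists_tendsto_abs_scaledH_sub_funH_le {α : ℝ} (hα : 0 < α) :
    ∃ δ : ℝ → ℝ, Tendsto δ atTop (𝓝 0) ∧ ∀ᶠ N in atTop, ∀ φ, 0 ≤ φ → φ ≤ N * (Real.pi / 2) →
      |scaledH α N φ - funH α φ| ≤ δ N := by
  set D : ℝ → ℝ := fun t => t ^ α * Real.exp (t / 2) / Real.sinh t with hD
  have hDint : IntegrableOn D (Set.Ioi 0) := integrableOn_rpow_mul_exp_half_div_sinh hα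
  -- G bounds the difference of the integrands for every admissible φ: 2 bounds the scaled kernel
  -- and multiplies the change of weight, and the second term is the limit weight times the change
  -- of kernel. Dominated convergence sends its integral to 0.
  set G : ℝ → ℝ → ℝ := fun N t => 2 * (scaledWeight α N t - t ^ α / Real.sinh t) +
    t ^ α / Real.sinh t * (1 / N + (1 - t ^ 2 / (N * Real.sinh (t / N)) ^ 2)) with hG
  have hwm : ∀ N, Measurable (scaledWeight α N) := fun N => by
    unfold scaledWeight
    fun_prop
  have hGm : ∀ N, Measurable (G N) := fun N => by
    have := hwm N
    simp only [hG]
    fun_prop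
  have hGle : ∀ N, 2 * (α + 1) ≤ N → ∀ t, 0 < t → ‖G N t‖ ≤ 4 * D t := by
    intro N hN t ht
    have hN0 : 0 < N := by linarith
    have hs := Real.sinh_pos_iff.2 ht
    have h1 := div_sinh_le_scaledWeight hα hN0 ht
    have h2 := scaledWeight_le hα hN ht
    have h3 := le_mul_sinh_div hN0 ht
    have h4 : 1 / N ≤ 1 := (div_le_one hN0).2 (by linarith)
    have h5 : t ^ 2 / (N * Real.sinh (t / N)) ^ 2 ≤ 1 :=
      (div_le_one (pow_pos (ht.trans_le h3) 2)).2 (by gcongr)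
    have h6 : 0 ≤ t ^ 2 / (N * Real.sinh (t / N)) ^ 2 := by positivity
    have h7 : 0 < t ^ α / Real.sinh t := by positivity
    have h8 : 0 < 1 / N := by positivity
    rw [Real.norm_of_nonneg (by
      simp only [hG]
      have := mul_nonneg h7.le (by linarith :
        0 ≤ 1 / N + (1 - t ^ 2 / (N * Real.sinh (t / N)) ^ 2))
      linarith)]
    simp only [hG, hD]
    have := mul_le_mul_of_nonneg_left (by linarith :
      1 / N + (1 - t ^ 2 / (N * Real.sinh (t / N)) ^ 2) ≤ 2) h7.le
    linarith
  refine ⟨fun N => ∫ t in Set.Ioi (0 : ℝ), G N t, ?_, ?_⟩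
  · have h := tendsto_integral_filter_of_dominated_convergence (μ := volume.restrict (Set.Ioi 0))
      (F := G) (f := fun _ => (0 : ℝ)) (l := atTop) (fun t => 4 * D t)
      (Eventually.of_forall fun N => (hGm N).aestronglyMeasurable) ?_ (hDint.const_mul 4) ?_
    · simpa using h
    · filter_upwards [eventually_ge_atTop (2 * (α + 1))] with N hN
      filter_upwards [ae_restrict_mem measurableSet_Ioi] with t ht using hGle N hN t ht
    · filter_upwards [ae_restrict_mem measurableSet_Ioi] with t (ht : 0 < t)
      have h1 := (tendsto_scaledWeight (α := α) ht).sub_const (t ^ α / Real.sinh t)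
      have h2 : Tendsto (fun N : ℝ => 1 / N) atTop (𝓝 0) :=
        tendsto_const_nhds.div_atTop tendsto_id
      have h3 := (tendsto_const_nhds (x := t ^ 2)).div ((tendsto_mul_sinh_div ht).pow 2)
        (by positivity)
      have h4 := (h1.const_mul 2).add ((h2.add (h3.const_sub 1)).const_mul (t ^ α / Real.sinh t))
      have ht2 : t ^ 2 / t ^ 2 = 1 := div_self (by positivity)
      simpa only [ht2, sub_self, mul_zero, add_zero, Pi.div_apply] using h4
  · filter_upwards [eventually_ge_atTop (2 * (α + 1))] with N hN φ h0 h1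
    have hN0 : 0 < N := by linarith
    have hint : IntegrableOn (fun t => scaledWeight α N t *
        (N * Real.sin (φ / N) * Real.sin φ /
          ((N * Real.sin (φ / N)) ^ 2 + (N * Real.sinh (t / N)) ^ 2))) (Set.Ioi 0) := by
      refine Integrable.mono' (hDint.const_mul 2) ?_ ?_
      · have := hwm N
        refine Measurable.aestronglyMeasurable ?_
        fun_prop
      · filter_upwards [ae_restrict_mem measurableSet_Ioi] with t (ht : 0 < t)
        have h2 := scaledWeight_le hα hN ht
        have hs := Real.sinh_pos_iff.2 ht
        have h3 : 0 ≤ scaledWeight α N t :=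
          le_trans (by positivity) (div_sinh_le_scaledWeight hα hN0 ht)
        rw [norm_mul, Real.norm_of_nonneg h3, mul_comm 2]
        exact mul_le_mul h2 (abs_scaled_kernel_le hN0 h0 h1) (abs_nonneg _) (h3.trans h2)
    rw [scaledH, funH, ← integral_sub hint (integrableOn_integrandH hα φ), ← Real.norm_eq_abs]
    have hGint : IntegrableOn (G N) (Set.Ioi 0) := by
      refine Integrable.mono' (hDint.const_mul 4) (hGm N).aestronglyMeasurable ?_
      filter_upwards [ae_restrict_mem measurableSet_Ioi] with t ht using hGle N hN t ht
    refine norm_integral_le_of_norm_le hGint ?_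
    filter_upwards [ae_restrict_mem measurableSet_Ioi] with t (ht : 0 < t)
    have hs := Real.sinh_pos_iff.2 ht
    have h2 := div_sinh_le_scaledWeight hα hN0 ht
    have h3 := abs_scaled_kernel_le (w := N * Real.sinh (t / N)) hN0 h0 h1
    have h4 := abs_scaled_kernel_sub_le hN0 h0 h1 ht (le_mul_sinh_div hN0 ht)
    have h7 : 0 < t ^ α / Real.sinh t := by positivity
    rw [integrandH]
    set K := N * Real.sin (φ / N) * Real.sin φ /
          ((N * Real.sin (φ / N)) ^ 2 + (N * Real.sinh (t / N)) ^ 2)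
    set K' := φ * Real.sin φ / (φ ^ 2 + t ^ 2)
    have e : scaledWeight α N t * K - t ^ α / Real.sinh t * K' =
        (scaledWeight α N t - t ^ α / Real.sinh t) * K + t ^ α / Real.sinh t * (K - K') := by ring
    rw [e, Real.norm_eq_abs]
    refine (abs_add_le _ _).trans (add_le_add ?_ ?_)
    · rw [abs_mul, abs_of_nonneg (sub_nonneg.2 h2), mul_comm]
      exact mul_le_mul_of_nonneg_right h3 (sub_nonneg.2 h2)
    · rw [abs_mul, abs_of_pos h7]
      exact mul_le_mul_of_nonneg_left h4 h7.le

/-! ### The error formula for every exponent, and the limit of the norms. -/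

theorem chebInterp_two_mul {m n : ℕ} (hmn : m ≤ n) :
    chebInterp ((2 * m : ℕ) : ℝ) n = Polynomial.X ^ (2 * m) := by
  symm
  rw [← chebInterp_unique]
  refine ⟨?_, fun x _ => ?_⟩
  · rw [Polynomial.degree_X_pow]
    exact_mod_cast (by omega : 2 * m < 2 * n + 1)
  · rw [Polynomial.eval_pow, Polynomial.eval_X, Real.rpow_natCast, Even.pow_abs (even_two_mul m)]

theorem eventually_rpow_mul_error_eq {α : ℝ} (hα : 0 < α) :
    ∀ᶠ n : ℕ in atTop, ∀ φ : ℝ, (2 * (n : ℝ) + 1) ^ α * (|Real.sin (φ / (2 * n + 1))| ^ α -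
      (chebInterp α n).eval (Real.sin (φ / (2 * n + 1)))) =
    2 / Real.pi * Real.sin (Real.pi * α / 2) * scaledH α (2 * n + 1) φ := by
  -- Taking k = ⌈α/2⌉ - 1 leaves b in (0, 2]. The endpoint b = 2, that is α an even integer, is
  -- outside the integral representation, but there both sides vanish.
  obtain ⟨k, b, h0, h2, rfl⟩ : ∃ (k : ℕ) (b : ℝ), 0 < b ∧ b ≤ 2 ∧ α = b + 2 * k := by
    have h1 := Nat.ceil_lt_add_one (by positivity : 0 ≤ α / 2)
    have h2 := Nat.le_ceil (α / 2)
    have h3 : 0 < ⌈α / 2⌉₊ := Nat.ceil_pos.2 (by positivity)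
    obtain ⟨k, hk⟩ : ∃ k, ⌈α / 2⌉₊ = k + 1 := ⟨_, (Nat.succ_pred_eq_of_pos h3).symm⟩
    rw [hk] at h1 h2
    push_cast at h1 h2
    exact ⟨k, α - 2 * k, by linarith, by linarith, by ring⟩
  filter_upwards [eventually_ge_atTop (k + 1)] with n hn φ
  rcases h2.lt_or_eq with h2 | rfl
  · exact rpow_mul_error_eq h0 h2 hn φ
  · have e : (2 + 2 * (k : ℝ)) = ((2 * (k + 1) : ℕ) : ℝ) := by
      push_cast
      ring
    have hs : Real.sin (Real.pi * (2 + 2 * (k : ℝ)) / 2) = 0 := by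
      rw [show Real.pi * (2 + 2 * (k : ℝ)) / 2 = ((k + 1 : ℕ) : ℝ) * Real.pi by push_cast; ring]
      exact Real.sin_nat_mul_pi _
    rw [hs, e, chebInterp_two_mul hn, Polynomial.eval_pow, Polynomial.eval_X, Real.rpow_natCast,
      Real.rpow_natCast, Even.pow_abs (even_two_mul _)]
    ring

theorem continuous_error {α : ℝ} (hα : 0 < α) (n : ℕ) :
    Continuous (fun x : ℝ => |x| ^ α - (chebInterp α n).eval x) :=
  (continuous_abs.rpow_const fun _ => Or.inr hα.le).sub (chebInterp α n).continuous

theorem memLp_error_and_isLUB {α : ℝ} (hα : 0 < α) (n : ℕ) :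
    MemLp (fun x : ℝ => |x| ^ α - (chebInterp α n).eval x) ∞ (volume.restrict (Set.Icc 0 1)) ∧
    IsLUB ((fun x : ℝ => |(|x| ^ α - (chebInterp α n).eval x)|) '' Set.Icc 0 1)
      (normLInfty (fun x : ℝ => |x| ^ α - (chebInterp α n).eval x) (Set.Icc 0 1)) := by
  obtain ⟨C, hC⟩ := isCompact_Icc.exists_bound_of_continuousOn
    (continuous_error hα n).continuousOn (s := Set.Icc 0 1)
  exact memLp_top_and_isLUB_normLInfty (continuous_error hα n) measurableSet_Icc ⟨0, by simp⟩
    (by rw [interior_Icc, closure_Ioo zero_ne_one]) hC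

theorem memLp_funH_and_isLUB {α : ℝ} (hα : 0 < α) :
    MemLp (funH α) ∞ (volume.restrict (Set.Ici 0)) ∧
    IsLUB ((fun x : ℝ => |funH α x|) '' Set.Ici 0) (normLInfty (funH α) (Set.Ici 0)) :=
  memLp_top_and_isLUB_normLInfty (continuous_funH hα) measurableSet_Ici ⟨0, by simp⟩
    (by rw [interior_Ici, closure_Ioi]) fun x _ => abs_funH_le hα x

theorem tendsto_rpow_mul_normLInfty_error {α : ℝ} (hα : 0 < α) :
    Tendsto (fun n : ℕ => (2 * (n : ℝ) + 1) ^ α *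
        normLInfty (fun x : ℝ => |x| ^ α - (chebInterp α n).eval x) (Set.Icc 0 1)) atTop
      (𝓝 (2 / Real.pi * |Real.sin (Real.pi * α / 2)| * normLInfty (funH α) (Set.Ici 0))) := by
  have hpi := Real.pi_pos
  obtain ⟨δ, hδ, hδle⟩ := exists_tendsto_abs_scaledH_sub_funH_le hα
  have hNtop : Tendsto (fun n : ℕ => 2 * (n : ℝ) + 1) atTop atTop :=
    tendsto_atTop_add_const_right _ _ (tendsto_natCast_atTop_atTop.const_mul_atTop two_pos)
  have hδ' := hδ.comp hNtop
  have hA := (memLp_funH_and_isLUB hα).2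
  set A := normLInfty (funH α) (Set.Ici 0)
  set C := 2 / Real.pi * |Real.sin (Real.pi * α / 2)| with hC
  have hC0 : 0 ≤ C := by positivity
  have habs : ∀ᶠ n : ℕ in atTop, ∀ φ : ℝ, (2 * (n : ℝ) + 1) ^ α *
      |(|Real.sin (φ / (2 * n + 1))| ^ α -
        (chebInterp α n).eval (Real.sin (φ / (2 * n + 1))))| = C * |scaledH α (2 * n + 1) φ| := by
    filter_upwards [eventually_rpow_mul_error_eq hα] with n hn φ
    have h := congrArg abs (hn φ)
    rwa [abs_mul, abs_mul, abs_mul, abs_of_pos (by positivity : (0 : ℝ) < (2 * n + 1) ^ α),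
      abs_of_pos (by positivity : 0 < 2 / Real.pi)] at h
  refine tendsto_order.2 ⟨fun a ha => ?_, fun a ha => ?_⟩
  -- Lower bound: a single φ that nearly attains the supremum suffices, since sin(φ/N) lies in [0,1]
  -- once N ≥ φ.
  · obtain ⟨φ, hφ0, hφ⟩ : ∃ φ, 0 ≤ φ ∧ a < C * |funH α φ| := by
      by_contra! hcon
      -- C = 0 occurs when α is an even integer; then a < 0 and φ = 0 serves.
      rcases hC0.eq_or_lt with h | h
      · have := hcon 0 le_rfl
        rw [← h] at this ha
        linarith
      · have : A ≤ a / C := hA.2 (by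
          rintro _ ⟨φ, hφ, rfl⟩
          rw [le_div_iff₀' h]
          exact hcon φ hφ)
        rw [le_div_iff₀' h] at this
        linarith
    have hlim : Tendsto (fun n : ℕ => C * (|funH α φ| - δ (2 * (n : ℝ) + 1))) atTop
        (𝓝 (C * |funH α φ|)) := by
      simpa using (hδ'.const_sub |funH α φ|).const_mul C
    filter_upwards [habs, hNtop.eventually hδle, hlim.eventually_const_lt hφ,
      hNtop.eventually_ge_atTop φ] with n h1 h2 h3 h4
    have hN : (0 : ℝ) < 2 * n + 1 := by positivity
    have hle : φ ≤ (2 * (n : ℝ) + 1) * (Real.pi / 2) :=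
      h4.trans (le_mul_of_one_le_right hN.le (by linarith [Real.pi_gt_three]))
    have hdist := h2 φ hφ0 hle
    have hx : Real.sin (φ / (2 * n + 1)) ∈ Set.Icc (0 : ℝ) 1 :=
      ⟨Real.sin_nonneg_of_nonneg_of_le_pi (by positivity)
        ((div_le_iff₀' hN).2 (by nlinarith)), Real.sin_le_one _⟩
    have hub := (memLp_error_and_isLUB hα n).2.1 ⟨_, hx, rfl⟩
    have h5 := mul_le_mul_of_nonneg_left hub (by positivity : (0 : ℝ) ≤ (2 * n + 1) ^ α)
    simp only at h5
    rw [h1 φ] at h5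
    refine h3.trans_le (le_trans (mul_le_mul_of_nonneg_left ?_ hC0) h5)
    have := abs_sub_abs_le_abs_sub (funH α φ) (scaledH α (2 * n + 1) φ)
    rw [abs_sub_comm] at this
    linarith
  -- Upper bound: each x in [0,1] is sin(φ/N) with φ = N arcsin x in [0, Nπ/2], so δ controls all x
  -- at once.
  · have hlim : Tendsto (fun n : ℕ => C * (A + δ (2 * (n : ℝ) + 1))) atTop (𝓝 (C * A)) := by
      simpa using (hδ'.const_add A).const_mul C
    filter_upwards [habs, hNtop.eventually hδle, hlim.eventually_lt_const ha] with n h1 h2 h3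
    have hN : (0 : ℝ) < 2 * n + 1 := by positivity
    refine lt_of_le_of_lt ?_ h3
    rw [← le_div_iff₀' (by positivity)]
    refine (memLp_error_and_isLUB hα n).2.2 ?_
    rintro _ ⟨x, hx, rfl⟩
    simp only
    rw [le_div_iff₀' (by positivity)]
    have hφ : Real.sin ((2 * (n : ℝ) + 1) * Real.arcsin x / (2 * n + 1)) = x := by
      rw [mul_div_cancel_left₀ _ hN.ne', Real.sin_arcsin (by linarith [hx.1]) hx.2]
    have h4 := h1 ((2 * (n : ℝ) + 1) * Real.arcsin x)
    rw [hφ] at h4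
    rw [h4]
    refine mul_le_mul_of_nonneg_left ?_ hC0
    have hφ0 : 0 ≤ (2 * (n : ℝ) + 1) * Real.arcsin x :=
      mul_nonneg hN.le (Real.arcsin_nonneg.2 hx.1)
    have h5 := h2 _ hφ0 (mul_le_mul_of_nonneg_left (Real.arcsin_le_pi_div_two x) hN.le)
    have h6 := hA.1 ⟨_, hφ0, rfl⟩
    simp only at h6
    have h7 := abs_sub_abs_le_abs_sub (scaledH α (2 * n + 1) ((2 * (n : ℝ) + 1) * Real.arcsin x))
      (funH α ((2 * (n : ℝ) + 1) * Real.arcsin x))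
    linarith

/-- Exchanges the natural normalization (2n+1)^α for (2n)^α. -/
theorem tendsto_two_mul_rpow_div (α : ℝ) :
    Tendsto (fun n : ℕ => (2 * (n : ℝ) / (2 * n + 1)) ^ α) atTop (𝓝 1) := by
  have h : Tendsto (fun n : ℕ => 2 * (n : ℝ) / (2 * n + 1)) atTop (𝓝 1) := by
    have hNtop : Tendsto (fun n : ℕ => 2 * (n : ℝ) + 1) atTop atTop :=
      tendsto_atTop_add_const_right _ _ (tendsto_natCast_atTop_atTop.const_mul_atTop two_pos)
    have h1 : Tendsto (fun n : ℕ => 1 - 1 / (2 * (n : ℝ) + 1)) atTop (𝓝 (1 - 0)) :=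
      (tendsto_const_nhds.div_atTop hNtop).const_sub 1
    rw [sub_zero] at h1
    refine h1.congr fun n => ?_
    have : (0 : ℝ) < 2 * n + 1 := by positivity
    field_simp
    ring
  simpa using h.rpow_const (p := α) (Or.inl one_ne_zero)

theorem theorem3p1 (α : ℝ) (hα : 0 < α) :
    (∀ x : ℝ, 0 ≤ x → IntegrableOn (integrandH α x) (Set.Ioi 0)) ∧
    MemLp (funH α) ∞ (volume.restrict (Set.Ici 0)) ∧
    (∀ n : ℕ, MemLp (fun x : ℝ => |x| ^ α - (chebInterp α n).eval x) ∞
      (volume.restrict (Set.Icc 0 1))) ∧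
    Tendsto (fun n : ℕ => (2 * (n : ℝ)) ^ α *
        normLInfty (fun x : ℝ => |x| ^ α - (chebInterp α n).eval x) (Set.Icc 0 1)) atTop
      (𝓝 (2 / Real.pi * |Real.sin (Real.pi * α / 2)| * normLInfty (funH α) (Set.Ici 0))) ∧
    IsLUB ((fun x : ℝ => ∫ t in Set.Ioi (0 : ℝ),
        t ^ α / Real.sinh t * (x * |Real.sin x| / (x ^ 2 + t ^ 2))) '' Set.Ici 0)
      (normLInfty (funH α) (Set.Ici 0)) := by
  refine ⟨fun x _ => integrableOn_integrandH hα x, (memLp_funH_and_isLUB hα).1,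
    fun n => (memLp_error_and_isLUB hα n).1, ?_, ?_⟩
  · have h := (tendsto_two_mul_rpow_div α).mul (tendsto_rpow_mul_normLInfty_error hα)
    rw [one_mul] at h
    refine h.congr fun n => ?_
    rw [← mul_assoc, ← Real.mul_rpow (by positivity) (by positivity),
      div_mul_cancel₀ _ (by positivity)]
  · rw [Set.image_congr fun x (hx : x ∈ Set.Ici (0 : ℝ)) => integral_abs_sin_eq_abs_funH α hx]
    exact (memLp_funH_and_isLUB hα).2
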